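/- A graph here is a finite looped simple graph: a set $V(G)$ of vertices in which each vertex may or may not carry one loop, and each two distinct vertices may or may not be joined by one edge. The open neighborhood is $N_G(v)=\{w\ne v : vw\in E(G)\}$; the degree of $v$ is $|N_G(v)|$, plus $2$ if $v$ is looped. The loop complement of $G$ at $v$ reverses the loop status of $v$; the simple local complement of $G$ at $v$ reverses all adjacencies between distinct elements of $N_G(v)$; the non-simple local complement at $v$ does this and also reverses the loop status of every element of $N_G(v)$. Two graphs on the same vertex set are locally equivalent if one is obtained from the other by a finite sequence of these three operations. Let $A(G)$ be the $V(G)\times V(G)$ adjacency matrix over $GF(2)$ (with diagonal entry $1$ exactly at looped vertices), and let $M[IAS(G)]$ be the binary matroid represented by the columns of $IAS(G)=\begin{pmatrix} I & A(G) & A(G)+I\end{pmatrix}$; its $3n$ elements are grouped into the vertex triples consisting of the $v$ columns of $I$, $A(G)$ and $A(G)+I$, for $v\in V(G)$. A transversal is a set of elements that meets every vertex triple exactly once, and a transverse circuit is a circuit of the restriction of $M[IAS(G)]$ to a transversal. For a matroid $M$ with ground set $W$ and rank function $r$, and a positive integer $k$, a vertical $k$-separation is a set $S\subseteq W$ with $r(S)+r(W-S)-r(M)<k$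 and $r(S),r(W-S)\ge k$; $\kappa(M)$ is the minimum of $r(M)$ and all $k$ for which $M$ has a vertical $k$-separation; and $M$ is vertically $j$-connected if $2\le j\le\kappa(M)$. **Corollary.** Let $G$ be a graph with $n\ge 7$ vertices. Then: 1. $G$ is locally equivalent to a graph with a vertex of degree $<\frac{n-1}{2}$; 2. $M[IAS(G)]$ is not vertically $n$-connected; 3. $M[IAS(G)]$ has a transverse circuit of size $\le\frac n2$. -/

import Mathlib

/-- A looped simple graph on the vertex set `V`: `G.Edge v w` says that there is an edge whose set of
ends is `{v, w}`, so `G.Edge v v` says that `v` is looped. -/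
@[ext]
structure LoopedGraph (V : Type*) where
  Edge : V → V → Prop
  symm : ∀ v w, Edge v w → Edge w v

namespace LoopedGraph

variable {V : Type*}

/-- The open neighborhood `N_G(v)`; no vertex is its own neighbor, looped or not. -/
def neighbors (G : LoopedGraph V) (v : V) : Set V := {w | w ≠ v ∧ G.Edge v w}

open Classical in
/-- The degree of a vertex; a loop counts twice. -/
noncomputable def degree (G : LoopedGraph V) (v : V) : ℕ :=
  (G.neighbors v).ncard + if G.Edge v v then 2 else 0

/-- Reverse the loop status of every vertex in `X`. -/
def loopComplementOn (G : LoopedGraph V) (X : Set V) : LoopedGraph V where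
  Edge a b := Xor (G.Edge a b) (a = b ∧ a ∈ X)
  symm a b h := by
    have := G.symm a b
    have := G.symm b a
    by_cases hab : a = b
    · subst hab; exact h
    · simp only [Xor, hab, Ne.symm hab] at h ⊢
      tauto

/-- The loop complement of `G` with respect to `v`. -/
def loopComplement (G : LoopedGraph V) (v : V) : LoopedGraph V := G.loopComplementOn {v}

/-- The simple local complement of `G` with respect to `v`: reverse all adjacencies between distinct
neighbors of `v`. -/
def simpleLocalComplement (G : LoopedGraph V) (v : V) : LoopedGraph V where
  Edge a b := Xor (G.Edge a b) (a ≠ b ∧ a ∈ G.neighbors v ∧ b ∈ G.neighbors v)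
  symm a b h := by
    have := G.symm a b
    have := G.symm b a
    have : a ≠ b ↔ b ≠ a := ne_comm
    simp only [Xor] at h ⊢
    tauto

/-- The non-simple local complement of `G` with respect to `v`: the simple local complement, followed
by loop complementations at all neighbors of `v`. -/
def nonSimpleLocalComplement (G : LoopedGraph V) (v : V) : LoopedGraph V :=
  (G.simpleLocalComplement v).loopComplementOn (G.neighbors v)

/-- `H` is obtained from `G` by one local complementation or loop complementation. -/
inductive LocalStep (G : LoopedGraph V) : LoopedGraph V → Prop
  | loop (v : V) : LocalStep G (G.loopComplement v)
  | simple (v : V) : LocalStep G (G.simpleLocalComplement v)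
  | nonSimple (v : V) : LocalStep G (G.nonSimpleLocalComplement v)

/-- `H` is obtained from `G` by a finite sequence of local complementations and loop
complementations. Each step is an involution, so this is a symmetric relation. -/
def LocallyEquivalent (G H : LoopedGraph V) : Prop := Relation.ReflTransGen LocalStep G H

end LoopedGraph

/-- The matroid represented by a matrix: its elements are the (indices of) columns, and a set is
independent when the corresponding family of columns is linearly independent. -/
def Matrix.columnMatroid {m E F : Type*} [Finite E] [Field F] (A : Matrix m E F) : Matroid E :=
  (IndepMatroid.ofFinite (E := Set.univ) Set.finite_univ
    (fun I => LinearIndepOn F A.col I)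
    (linearIndepOn_empty F A.col)
    (fun _ _ hJ hIJ => hJ.mono hIJ)
    (by
      intro I J hI hJ hlt
      by_contra! hcon
      have hspan : ∀ e ∈ J, A.col e ∈ Submodule.span F (A.col '' I) := by
        intro e he
        by_cases heI : e ∈ I
        · exact Submodule.subset_span (Set.mem_image_of_mem _ heI)
        · by_contra hne
          exact hcon e he heI (hI.insert hne)
      have hfin : (A.col '' I).Finite := Set.toFinite _
      have : FiniteDimensional F (Submodule.span F (A.col '' I)) :=
        FiniteDimensional.span_of_finite F hfin
      have hle : Submodule.span F (A.col '' J) ≤ Submodule.span F (A.col '' I) := by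
        rw [Submodule.span_le]
        rintro _ ⟨e, he, rfl⟩
        exact hspan e he
      have hrank : ∀ K : Set E, LinearIndepOn F A.col K →
          Module.finrank F (Submodule.span F (A.col '' K)) = K.ncard := by
        intro K hK
        have : Fintype K := Fintype.ofFinite K
        have h := finrank_span_eq_card (R := F) (b := fun x : K => A.col x) hK
        rw [show Set.range (fun x : K => A.col x) = A.col '' K by
          ext y; simp] at h
        rw [h, ← Nat.card_eq_fintype_card, Nat.card_coe_set_eq]
      have := Submodule.finrank_mono hle
      rw [hrank I hI, hrank J hJ] at this
      omega)
    (fun _ _ => Set.subset_univ _)).matroid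

namespace Matroid

variable {α : Type*}

/-- The rank function of a finite matroid, as a natural number. -/
noncomputable def natRk (M : Matroid α) [M.Finite] (S : Set α) : ℕ := (M.eRk S).toNat

/-- The connectivity function `λ(S) = r(S) + r(W - S) - r(M)`. -/
noncomputable def connectivityFunction (M : Matroid α) [M.Finite] (S : Set α) : ℤ :=
  (M.natRk S : ℤ) + (M.natRk (M.E \ S) : ℤ) - (M.natRk M.E : ℤ)

/-- `S` is a vertical `k`-separation of `M`. -/
def IsVerticalSeparation (M : Matroid α) [M.Finite] (k : ℕ) (S : Set α) : Prop :=
  1 ≤ k ∧ S ⊆ M.E ∧ M.connectivityFunction S < (k : ℤ) ∧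
    k ≤ M.natRk S ∧ k ≤ M.natRk (M.E \ S)

/-- The vertical connectivity `κ(M)`, the minimum of a nonempty set of natural numbers. -/
noncomputable def verticalConnectivity (M : Matroid α) [M.Finite] : ℕ :=
  sInf ({k | ∃ S, M.IsVerticalSeparation k S} ∪ {M.natRk M.E})

/-- `M` is vertically `j`-connected, where `2 ≤ j ≤ κ(M)`. -/
def IsVerticallyConnected (M : Matroid α) [M.Finite] (j : ℕ) : Prop :=
  2 ≤ j ∧ j ≤ M.verticalConnectivity

end Matroid

namespace LoopedGraph

variable {V : Type*}

open Classical in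
/-- The adjacency matrix `A(G)` over `GF(2)`; looped vertices have diagonal entry `1`. -/
noncomputable def adjMatrix (G : LoopedGraph V) : Matrix V V (ZMod 2) :=
  Matrix.of fun v w => if G.Edge v w then 1 else 0

/-- The index set of the columns of `(I | A | A + I)`. -/
abbrev Column (V : Type*) := V ⊕ (V ⊕ V)

/-- The element `φ(v)`, the `v` column of `I`. -/
def phi (v : V) : Column V := Sum.inl v

/-- The element `χ(v)`, the `v` column of `A(G)`. -/
def chi (v : V) : Column V := Sum.inr (Sum.inl v)

/-- The element `ψ(v)`, the `v` column of `A(G) + I`. -/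
def psi (v : V) : Column V := Sum.inr (Sum.inr v)

open Classical in
/-- The matrix `IAS(G) = (I | A(G) | A(G) + I)`. -/
noncomputable def IAS (G : LoopedGraph V) : Matrix V (Column V) (ZMod 2) :=
  Matrix.fromCols 1 (Matrix.fromCols G.adjMatrix (G.adjMatrix + 1))

/-- The isotropic matroid `M[IAS(G)]`. -/
noncomputable def isotropicMatroid [Finite V] (G : LoopedGraph V) : Matroid (Column V) :=
  G.IAS.columnMatroid

/-- The vertex triple of `v`. -/
def vertexTriple (v : V) : Set (Column V) := {phi v, chi v, psi v}

/-- A transversal meets every vertex triple precisely once. -/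
def IsTransversal (T : Set (Column V)) : Prop := ∀ v, (T ∩ vertexTriple v).ncard = 1

/-- A transverse circuit of `G` is a circuit of the restriction of the isotropic matroid to a
transversal. -/
def IsTransverseCircuit [Finite V] (G : LoopedGraph V) (C : Set (Column V)) : Prop :=
  ∃ T, IsTransversal T ∧ (G.isotropicMatroid.restrict T).IsCircuit C

end LoopedGraph

/-! Let A be the adjacency matrix over GF(2) and n the number of vertices. The vectors (x, A x),
read as one pair of bits per vertex, form a symplectic self-dual code of length n; the weight of a
word is its number of nonzero pairs. All three conclusions follow from one nonzero word of weight at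
most n/2 (`exists_light_word`).

Without such a word, self-duality (`finrank_wordsIn_compl`) forces exactly 2^(2s-n) words inside
every set of s ≥ n/2 vertices, so the number of words with a given support depends only on its size
and is found recursively. At size ⌊n/2⌋ + 2 it is negative for even n ≥ 8 and for odd n ≥ 13. For n
= 7, 9, 11 the numbers contradict additivity of weight parity, by which all or exactly half of the
words inside a set are even.

A light word spells out a linear dependence among columns of one transversal, hence a small
transverse circuit. Together with a word supported off its support, it shows that two complementary
unions of vertex triples both have rank below n, hence a vertical separation of order below n.
Finally, local complementation acts on words and preserves supports; it turns a light word into one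
from which some unit vector e_v is no heavier, and the support of the word of e_v is the closed
neighborhood of v. -/

namespace Matrix

/-! ### Words of the code and self-duality -/

open Finset

variable {V : Type*} [Fintype V]

open Classical in
/-- The positions at which the word `(x, A x)`, read as a pair of bits at every vertex, is nonzero. -/
noncomputable def wordSupport (A : Matrix V V (ZMod 2)) (x : V → ZMod 2) : Finset V :=
  {v | x v ≠ 0 ∨ (A *ᵥ x) v ≠ 0}

theorem notMem_wordSupport {A : Matrix V V (ZMod 2)} {x : V → ZMod 2} {v : V} :
    v ∉ A.wordSupport x ↔ x v = 0 ∧ (A *ᵥ x) v = 0 := by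
  simp [wordSupport]

/-- The words whose support is contained in `S`. -/
def wordsIn (A : Matrix V V (ZMod 2)) (S : Finset V) : Submodule (ZMod 2) (V → ZMod 2) where
  carrier := {x | ∀ v ∉ S, x v = 0 ∧ (A *ᵥ x) v = 0}
  add_mem' hx hy v hv := by
    simp [mulVec_add, hx v hv, hy v hv]
  zero_mem' v _ := by simp
  smul_mem' c x hx v hv := by simp [mulVec_smul, hx v hv]

theorem mem_wordsIn {A : Matrix V V (ZMod 2)} {S : Finset V} {x : V → ZMod 2} :
    x ∈ A.wordsIn S ↔ A.wordSupport x ⊆ S := by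
  change (∀ v ∉ S, x v = 0 ∧ (A *ᵥ x) v = 0) ↔ _
  simp only [← notMem_wordSupport, Finset.subset_iff, not_imp_not]

open Classical in
/-- Words supported in `S` form the kernel of the off-diagonal block of `A` with columns in `S`. -/
theorem finrank_wordsIn_add_rank (A : Matrix V V (ZMod 2)) (S : Finset V) :
    Module.finrank (ZMod 2) (A.wordsIn S) +
      (A.submatrix (fun v : {v // v ∉ S} => (v : V)) (fun v : {v // v ∈ S} => (v : V))).rank =
      #S := by
  set B := A.submatrix (fun v : {v // v ∉ S} => (v : V)) (fun v : {v // v ∈ S} => (v : V)) with hB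
  have key : ∀ x : V → ZMod 2, (∀ v ∉ S, x v = 0) → ∀ w : {v // v ∉ S},
      (B *ᵥ fun v => x v) w = (A *ᵥ x) w := by
    intro x hx w
    simp only [mulVec, dotProduct, hB, submatrix_apply]
    rw [Finset.sum_coe_sort S (fun v => A w v * x v)]
    exact Finset.sum_subset (Finset.subset_univ S) fun v _ hv => by simp [hx v hv]
  have e : A.wordsIn S ≃ₗ[ZMod 2] LinearMap.ker B.mulVecLin := by
    have hmem : ∀ x : A.wordsIn S,
        (LinearMap.funLeft (ZMod 2) (ZMod 2) (Subtype.val : {v // v ∈ S} → V) ∘ₗ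
          (A.wordsIn S).subtype) x ∈ LinearMap.ker B.mulVecLin := by
      intro x
      rw [LinearMap.mem_ker]
      ext w
      exact (key x.1 (fun v hv => (x.2 v hv).1) w).trans (x.2 w w.2).2
    refine LinearEquiv.ofBijective (LinearMap.codRestrict _ _ hmem) ⟨?_, ?_⟩
    · rintro ⟨x, hx⟩ ⟨y, hy⟩ hxy
      ext v
      by_cases hv : v ∈ S
      · exact congrFun (congrArg Subtype.val hxy) ⟨v, hv⟩
      · exact (hx v hv).1.trans (hy v hv).1.symm
    · rintro ⟨y, hy⟩
      have hx : ∀ v ∉ S, (fun v => if h : v ∈ S then y ⟨v, h⟩ else 0) v = 0 := by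
        intro v hv; simp [hv]
      have hxy : (fun v : {v // v ∈ S} => (fun v => if h : v ∈ S then y ⟨v, h⟩ else 0) v.1) = y := by
        ext v; simp
      refine ⟨⟨fun v => if h : v ∈ S then y ⟨v, h⟩ else 0, fun v hv => ⟨hx v hv, ?_⟩⟩, ?_⟩
      · rw [← key _ hx ⟨v, hv⟩, hxy]
        exact congrFun hy _
      · exact Subtype.ext hxy
  rw [e.finrank_eq, add_comm, Matrix.rank, LinearMap.finrank_range_add_finrank_ker]
  simp

open Classical in
-- Since `A` is symmetric, the off-diagonal blocks for `S` and `Sᶜ` are transposes of each other and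
-- have equal rank; subtract the two rank-nullity identities.
theorem finrank_wordsIn_compl (A : Matrix V V (ZMod 2)) (hA : A.IsSymm) (S : Finset V) :
    Module.finrank (ZMod 2) (A.wordsIn S) + Fintype.card V =
      Module.finrank (ZMod 2) (A.wordsIn Sᶜ) + 2 * #S := by
  have h₁ := finrank_wordsIn_add_rank A S
  have h₂ := finrank_wordsIn_add_rank A Sᶜ
  have hrank : (A.submatrix (fun v : {v // v ∉ Sᶜ} => (v : V))
      (fun v : {v // v ∈ Sᶜ} => (v : V))).rank =
      (A.submatrix (fun v : {v // v ∉ S} => (v : V)) (fun v : {v // v ∈ S} => (v : V))).rank := by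
    rw [← Matrix.rank_transpose, transpose_submatrix, hA.eq]
    rw [← Matrix.rank_submatrix (A.submatrix (fun v : {v // v ∉ S} => (v : V))
        (fun v : {v // v ∈ S} => (v : V)))
      (Equiv.subtypeEquivRight fun v => by simp : {v // v ∈ Sᶜ} ≃ {v // v ∉ S})
      (Equiv.subtypeEquivRight fun v => by simp : {v // v ∉ Sᶜ} ≃ {v // v ∈ S})]
    rfl
  rw [hrank] at h₂
  have := Finset.card_add_card_compl S
  omega

/-! ### Counting words by support -/

/-- The number of words whose support is contained in `S`. -/
noncomputable def numWordsIn (A : Matrix V V (ZMod 2)) (S : Finset V) : ℕ :=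
  Nat.card (A.wordsIn S)

theorem numWordsIn_eq_two_pow (A : Matrix V V (ZMod 2)) (S : Finset V) :
    A.numWordsIn S = 2 ^ Module.finrank (ZMod 2) (A.wordsIn S) := by
  rw [numWordsIn, Module.natCard_eq_pow_finrank (K := ZMod 2), Nat.card_zmod]

open Classical in
/-- The number of words whose support is exactly `T`. -/
noncomputable def numWords (A : Matrix V V (ZMod 2)) (T : Finset V) : ℕ :=
  #{x | A.wordSupport x = T}

open Classical in
theorem sum_powerset_numWords (A : Matrix V V (ZMod 2)) (S : Finset V) :
    ∑ T ∈ S.powerset, A.numWords T = A.numWordsIn S := by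
  rw [numWordsIn, Nat.card_eq_fintype_card, Fintype.card_subtype,
    Finset.card_eq_sum_card_fiberwise (f := A.wordSupport) (t := S.powerset)]
  · refine Finset.sum_congr rfl fun T hT => ?_
    rw [numWords, Finset.filter_filter]
    congr 1
    ext x
    simp only [mem_filter, mem_univ, true_and, mem_wordsIn]
    constructor
    · rintro rfl
      exact ⟨Finset.mem_powerset.1 hT, rfl⟩
    · exact fun h => h.2
  · intro x hx
    simpa [mem_wordsIn] using hx

open Classical in
theorem sum_powerset_numWords_even (A : Matrix V V (ZMod 2)) (S : Finset V) :
    ∑ T ∈ S.powerset, (if Even #T then A.numWords T else 0) =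
      #{x | A.wordSupport x ⊆ S ∧ Even #(A.wordSupport x)} := by
  rw [Finset.card_eq_sum_card_fiberwise (f := A.wordSupport) (t := S.powerset)]
  · refine Finset.sum_congr rfl fun T hT => ?_
    rw [numWords, Finset.filter_filter]
    rw [Finset.mem_powerset] at hT
    split_ifs with hE
    · congr 1
      ext x
      simp only [mem_filter, mem_univ, true_and]
      constructor
      · rintro rfl
        exact ⟨⟨hT, hE⟩, rfl⟩
      · exact fun h => h.2
    · symm
      rw [Finset.card_eq_zero, Finset.filter_eq_empty_iff]
      rintro x - ⟨⟨-, h⟩, rfl⟩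
      exact hE h
  · intro x hx
    simp only [coe_filter, mem_univ, true_and, Set.mem_ofPred_eq] at hx
    simpa using hx.1

/-! ### Parity of weights -/

/-- The weight of a word modulo two, as a polynomial in its bits. -/
theorem card_wordSupport_cast (A : Matrix V V (ZMod 2)) (x : V → ZMod 2) :
    (#(A.wordSupport x) : ZMod 2) = ∑ v, (x v + (A *ᵥ x) v + x v * (A *ᵥ x) v) := by
  classical
  rw [wordSupport, Finset.card_filter, Nat.cast_sum]
  refine Finset.sum_congr rfl fun v _ => ?_
  generalize x v = a
  generalize (A *ᵥ x) v = b
  revert a b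
  decide

/-- The parity of the weight is additive, because words are pairwise orthogonal. -/
theorem card_wordSupport_add (A : Matrix V V (ZMod 2)) (hA : A.IsSymm) (x y : V → ZMod 2) :
    (#(A.wordSupport (x + y)) : ZMod 2) = #(A.wordSupport x) + #(A.wordSupport y) := by
  simp only [card_wordSupport_cast]
  -- The cross terms of the quadratic polynomial add up to the symplectic form of the two words,
  -- which vanishes by symmetry of `A`.
  have hsymm : ∑ v, x v * (A *ᵥ y) v = ∑ v, y v * (A *ᵥ x) v := by
    change x ⬝ᵥ A *ᵥ y = y ⬝ᵥ A *ᵥ x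
    rw [Matrix.dotProduct_mulVec, ← Matrix.mulVec_transpose, hA.eq, dotProduct_comm]
  have h0 : ∑ v, (x v * (A *ᵥ y) v + y v * (A *ᵥ x) v) = 0 := by
    rw [Finset.sum_add_distrib, hsymm, CharTwo.add_self_eq_zero]
  rw [← add_zero (∑ v, _ + ∑ v, _), ← h0, ← Finset.sum_add_distrib, ← Finset.sum_add_distrib]
  refine Finset.sum_congr rfl fun v _ => ?_
  rw [mulVec_add]
  simp only [Pi.add_apply]
  ring

open Classical in
/-- Either all the words supported in `S` have even weight, or just half of them do. -/
theorem sum_even_numWords_dichotomy (A : Matrix V V (ZMod 2)) (hA : A.IsSymm) (S : Finset V) :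
    ∑ T ∈ S.powerset, (if Even #T then A.numWords T else 0) = A.numWordsIn S ∨
      2 * ∑ T ∈ S.powerset, (if Even #T then A.numWords T else 0) = A.numWordsIn S := by
  have hc : A.numWordsIn S = #{x | A.wordSupport x ⊆ S} := by
    rw [numWordsIn, Nat.card_eq_fintype_card, Fintype.card_subtype]
    simp only [mem_wordsIn]
  have hsplit := Finset.card_filter_add_card_filter_not
    (s := ({x | A.wordSupport x ⊆ S} : Finset _))
    (fun x => Even #(A.wordSupport x))
  rw [Finset.filter_filter, Finset.filter_filter] at hsplit
  rw [sum_powerset_numWords_even, hc, ← hsplit]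
  by_cases hodd : ∃ y, A.wordSupport y ⊆ S ∧ ¬ Even #(A.wordSupport y)
  · right
    obtain ⟨y, hyS, hy⟩ := hodd
    rw [two_mul]
    congr 1
    -- Translation by the odd word `y` exchanges even and odd words inside `S`.
    have hmem : ∀ x, A.wordSupport x ⊆ S → A.wordSupport (x + y) ⊆ S := fun x hx => by
      rw [← mem_wordsIn] at *
      exact Submodule.add_mem _ hx hyS
    have hpar : ∀ x, Even #(A.wordSupport (x + y)) ↔ ¬ Even #(A.wordSupport x) := fun x => by
      have := card_wordSupport_add A hA x y
      rw [← Nat.cast_add, ZMod.natCast_eq_natCast_iff] at this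
      have h2 : #(A.wordSupport (x + y)) % 2 = (#(A.wordSupport x) + #(A.wordSupport y)) % 2 := this
      rw [Nat.even_iff] at hy ⊢
      rw [Nat.even_iff]
      omega
    have hyy : ∀ x : V → ZMod 2, x + y + y = x := fun x => by
      ext v
      simp [add_assoc, CharTwo.add_self_eq_zero]
    refine Finset.card_bij' (fun x _ => x + y) (fun x _ => x + y) ?_ ?_ ?_ ?_
    · intro x hx
      simp only [mem_filter, mem_univ, true_and] at hx ⊢
      exact ⟨hmem x hx.1, by rw [hpar]; exact not_not.2 hx.2⟩
    · intro x hx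
      simp only [mem_filter, mem_univ, true_and] at hx ⊢
      exact ⟨hmem x hx.1, (hpar x).2 hx.2⟩
    · exact fun x _ => hyy x
    · exact fun x _ => hyy x
  · left
    push Not at hodd
    symm
    rw [Nat.add_eq_left, Finset.card_eq_zero, Finset.filter_eq_empty_iff]
    rintro x - ⟨h1, h2⟩
    exact h2 (hodd x h1)

end Matrix

/-! ### Existence of a light word -/

namespace Matrix

open Finset

/-- The term of `S` itself is split off because it is the unknown that the recursion solves for. -/
theorem _root_.Finset.sum_powerset_eq_add_sum_range {V : Type*} {f : Finset V → ℕ} {g : ℕ → ℕ}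
    {S : Finset V} (h : ∀ T ⊂ S, f T = g #T) :
    ∑ T ∈ S.powerset, f T = f S + ∑ k ∈ range #S, (#S).choose k * g k := by
  classical
  rw [← Finset.insert_erase (Finset.mem_powerset_self S),
    Finset.sum_insert (Finset.notMem_erase _ _)]
  have h1 : ∑ T ∈ S.powerset.erase S, f T = ∑ T ∈ S.powerset.erase S, g #T := by
    refine Finset.sum_congr rfl fun T hT => h T ?_
    rw [Finset.mem_erase, Finset.mem_powerset] at hT
    exact hT.2.ssubset_of_ne hT.1
  have h2 := Finset.sum_powerset_apply_card g (x := S)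
  rw [Finset.sum_range_succ, ← Finset.insert_erase (Finset.mem_powerset_self S),
    Finset.sum_insert (Finset.notMem_erase _ _)] at h2
  simp only [smul_eq_mul, Nat.choose_self, one_mul] at h2
  rw [h1]
  omega

variable {V : Type*} [Fintype V]

theorem wordSupport_zero (A : Matrix V V (ZMod 2)) : A.wordSupport 0 = ∅ := by
  simp [wordSupport]

theorem wordSupport_eq_empty {A : Matrix V V (ZMod 2)} {x : V → ZMod 2} :
    A.wordSupport x = ∅ ↔ x = 0 := by
  refine ⟨fun h => ?_, fun h => h ▸ wordSupport_zero A⟩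
  ext v
  exact (notMem_wordSupport.1 (h ▸ Finset.notMem_empty v)).1

theorem numWords_empty (A : Matrix V V (ZMod 2)) : A.numWords ∅ = 1 := by
  simp only [numWords, wordSupport_eq_empty]
  rw [Finset.card_eq_one]
  exact ⟨0, by ext; simp⟩

theorem numWordsIn_of_light {A : Matrix V V (ZMod 2)}
    (hd : ∀ x ≠ 0, Fintype.card V < 2 * #(A.wordSupport x)) {S : Finset V}
    (hS : 2 * #S ≤ Fintype.card V) : A.numWordsIn S = 1 := by
  have : A.wordsIn S = ⊥ := by
    rw [Submodule.eq_bot_iff]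
    intro x hx
    by_contra hx0
    have h1 := hd x hx0
    have h2 := Finset.card_le_card (mem_wordsIn.1 hx)
    omega
  rw [numWordsIn, this, Nat.card_unique]

/-- The complement of `S` is too small to contain a nonzero word, so duality determines the
dimension. -/
theorem numWordsIn_of_heavy {A : Matrix V V (ZMod 2)} (hA : A.IsSymm)
    (hd : ∀ x ≠ 0, Fintype.card V < 2 * #(A.wordSupport x)) {S : Finset V}
    (hS : Fintype.card V ≤ 2 * #S) : A.numWordsIn S = 2 ^ (2 * #S - Fintype.card V) := by
  classical
  have h1 := numWordsIn_of_light hd (S := Sᶜ) (by rw [Finset.card_compl]; omega)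
  rw [numWordsIn_eq_two_pow, Nat.pow_eq_one] at h1
  have h2 := finrank_wordsIn_compl A hA S
  rw [numWordsIn_eq_two_pow]
  congr 1
  omega

theorem numWords_of_light {A : Matrix V V (ZMod 2)}
    (hd : ∀ x ≠ 0, Fintype.card V < 2 * #(A.wordSupport x)) {T : Finset V}
    (hT : 2 * #T ≤ Fintype.card V) (hT0 : T ≠ ∅) : A.numWords T = 0 := by
  classical
  rw [numWords, Finset.card_eq_zero, Finset.filter_eq_empty_iff]
  rintro x - rfl
  have := hd x (fun h => hT0 (wordSupport_eq_empty.2 h))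
  omega

/-- If the number of words with a given support depends only on the size of a support smaller
than `s`, then it does so at size `s`, where it is determined recursively. -/
theorem numWords_of_card {A : Matrix V V (ZMod 2)} (hA : A.IsSymm)
    (hd : ∀ x ≠ 0, Fintype.card V < 2 * #(A.wordSupport x)) {g : ℕ → ℕ} {s : ℕ}
    (hs : Fintype.card V ≤ 2 * s) (hg : ∀ T : Finset V, #T < s → A.numWords T = g #T)
    {S : Finset V} (hS : #S = s) :
    A.numWords S + ∑ k ∈ range s, s.choose k * g k = 2 ^ (2 * s - Fintype.card V) := by
  subst hS
  rw [← numWordsIn_of_heavy hA hd hs, ← sum_powerset_numWords]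
  exact (Finset.sum_powerset_eq_add_sum_range fun T hT => hg T (Finset.card_lt_card hT)).symm

/-- Parity dichotomy when the number of words with a given support is a function `g` of its size. -/
theorem even_count_of_card {A : Matrix V V (ZMod 2)} (hA : A.IsSymm)
    (hd : ∀ x ≠ 0, Fintype.card V < 2 * #(A.wordSupport x)) {g : ℕ → ℕ} {s : ℕ}
    (hs : Fintype.card V ≤ 2 * s) (hsV : s ≤ Fintype.card V)
    (hg : ∀ T : Finset V, #T ≤ s → A.numWords T = g #T) :
    (∑ k ∈ range (s + 1), s.choose k * if Even k then g k else 0) =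
        2 ^ (2 * s - Fintype.card V) ∨
      2 * (∑ k ∈ range (s + 1), s.choose k * if Even k then g k else 0) =
        2 ^ (2 * s - Fintype.card V) := by
  classical
  obtain ⟨S, -, rfl⟩ := Finset.exists_subset_card_eq (s := (univ : Finset V)) (n := s) (by simpa)
  have h := sum_even_numWords_dichotomy A hA S
  rw [numWordsIn_of_heavy hA hd hs] at h
  have h1 : ∑ T ∈ S.powerset, (if Even #T then A.numWords T else 0) =
      ∑ T ∈ S.powerset, (if Even #T then g #T else 0) := by
    refine Finset.sum_congr rfl fun T hT => ?_
    rw [hg T (Finset.card_le_card (Finset.mem_powerset.1 hT))]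
  rw [h1, Finset.sum_powerset_apply_card (fun k => if Even k then g k else 0)] at h
  simpa only [smul_eq_mul] using h

theorem sum_choose_mul_of_support (m a : ℕ) :
    ∑ k ∈ range (m + 2), (m + 2).choose k * (if k = 0 then 1 else if k = m + 1 then a else 0) =
      1 + (m + 2) * a := by
  rw [Finset.sum_range_succ, Finset.sum_range_succ', Finset.sum_eq_zero]
  · simp [Nat.choose_succ_self_right]
  · intro k hk
    rw [Finset.mem_range] at hk
    simp [hk.ne]

/-- A symplectic self-dual code of length at least seven has a nonzero word of weight at most half
the length. -/
theorem exists_light_word (A : Matrix V V (ZMod 2)) (hA : A.IsSymm) (hn : 7 ≤ Fintype.card V) :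
    ∃ x ≠ 0, 2 * #(A.wordSupport x) ≤ Fintype.card V := by
  by_contra! hd
  -- Length six (`m = 3`, `a = 0`) must stay excluded: the hexacode has minimum weight four.
  obtain ⟨m, a, hm, ha, hcard⟩ : ∃ m a : ℕ, 3 ≤ m ∧ (a = 0 ∧ 4 ≤ m ∨ a = 1) ∧
      Fintype.card V = 2 * m + a :=
    ⟨Fintype.card V / 2, Fintype.card V % 2, by omega, by omega, by omega⟩
  have h0 : ∀ T : Finset V, #T < m + 1 → A.numWords T = if #T = 0 then 1 else 0 := by
    intro T hT
    split_ifs with h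
    · rw [Finset.card_eq_zero.1 h, numWords_empty]
    · exact numWords_of_light hd (by omega) (fun h' => h (by simp [h']))
  have h1 : ∀ T : Finset V, #T = m + 1 → A.numWords T = 2 ^ (2 - a) - 1 := by
    intro T hT
    have := numWords_of_card hA hd (g := fun k => if k = 0 then 1 else 0) (by omega) h0 hT
    rw [Finset.sum_range_succ', Finset.sum_eq_zero (by simp)] at this
    simp only [Nat.choose_zero_right, if_true] at this
    rw [show 2 * (m + 1) - Fintype.card V = 2 - a by omega] at this
    omega
  have h2 : ∀ T : Finset V, #T = m + 2 →
      A.numWords T + (1 + (m + 2) * (2 ^ (2 - a) - 1)) = 2 ^ (4 - a) := by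
    intro T hT
    have := numWords_of_card hA hd (s := m + 2)
      (g := fun k => if k = 0 then 1 else if k = m + 1 then 2 ^ (2 - a) - 1 else 0) (by omega)
      (fun U hU => by
        by_cases hU1 : #U = m + 1
        · simp only [hU1, if_true, h1 U hU1]; simp
        · simp only [hU1, if_false, h0 U (by omega)]) hT
    rwa [sum_choose_mul_of_support, show 2 * (m + 2) - Fintype.card V = 4 - a by omega] at this
  obtain ⟨S, -, hS⟩ := Finset.exists_subset_card_eq (s := (univ : Finset V)) (n := m + 2)
    (by rw [Finset.card_univ]; omega)
  have hSm := h2 S hS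
  -- For even length the number at size `m + 2` would be 9 - 3m, negative once m ≥ 4.
  rcases ha with ⟨rfl, hm4⟩ | rfl
  · norm_num at hSm
    omega
  norm_num at h1 h2 hSm
  -- For odd length the number at size `m + 2` is 5 - m; `hSm` forces m ≤ 5, so the subtraction is
  -- not truncated.
  have h12 : ∀ T : Finset V, #T ≤ m + 2 → A.numWords T =
      if #T = 0 then 1 else if #T = m + 1 then 1 else if #T = m + 2 then 5 - m else 0 := by
    intro T hT
    rcases (by omega : #T < m + 1 ∨ #T = m + 1 ∨ #T = m + 2) with h | h | h
    · rw [h0 T h, if_neg (show ¬ #T = m + 1 by omega), if_neg (show ¬ #T = m + 2 by omega)]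
    · simp [h1 T h, h]
    · have := h2 T h
      simp only [h]
      simp
      omega
  have hm5 : m ≤ 5 := by omega
  interval_cases m
  -- Length 7: of the 8 words inside a five-set, 1 + 5 = 6 are even, neither all nor half.
  · have := even_count_of_card hA hd (s := 5) (by omega) (by omega)
      (g := fun k => if k = 0 then 1 else if k = 3 + 1 then 1 else
        if k = 3 + 2 then 5 - 3 else 0) h12
    rw [hcard] at this
    revert this
    decide
  -- Length 9: of the 8 words inside a six-set, 1 + 1 = 2 are even.
  · have := even_count_of_card hA hd (s := 6) (by omega) (by omega)
      (g := fun k => if k = 0 then 1 else if k = 4 + 1 then 1 else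
        if k = 4 + 2 then 5 - 4 else 0) h12
    rw [hcard] at this
    revert this
    decide
  -- Length 11: up to size eight all words are even, so there is no contradiction yet; of the 128
  -- words inside a nine-set, 112 are even.
  · let g₇ : ℕ → ℕ := fun k =>
      if k = 0 then 1 else if k = 5 + 1 then 1 else if k = 5 + 2 then 5 - 5 else 0
    let g₈ : ℕ → ℕ := fun k =>
      if k = 0 then 1 else if k = 6 then 1 else if k = 8 then 3 else 0
    have h8 : ∀ T : Finset V, #T ≤ 8 → A.numWords T =
        if #T = 0 then 1 else if #T = 6 then 1 else if #T = 8 then 3 else 0 := by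
      intro T hT
      by_cases hT8 : #T = 8
      · have := numWords_of_card hA hd (g := g₇) (by omega) (fun U hU => h12 U (by omega)) hT8
        rw [hcard, show ∑ k ∈ range 8, Nat.choose 8 k * g₇ k = 29 by decide] at this
        simp only [hT8]
        norm_num at this ⊢
        omega
      · rw [h12 T (by omega)]
        simp [hT8]
    have h9 : ∀ T : Finset V, #T ≤ 9 → A.numWords T =
        if #T = 0 then 1 else if #T = 6 then 1 else if #T = 8 then 3 else if #T = 9 then 16
          else 0 := by
      intro T hT
      by_cases hT9 : #T = 9
      · have := numWords_of_card hA hd (g := g₈) (by omega) (fun U hU => h8 U (by omega)) hT9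
        rw [hcard, show ∑ k ∈ range 9, Nat.choose 9 k * g₈ k = 112 by decide] at this
        simp only [hT9]
        norm_num at this ⊢
        omega
      · rw [h8 T (by omega)]
        simp [hT9]
    have := even_count_of_card hA hd (s := 9) (by omega) (by omega)
      (g := fun k => if k = 0 then 1 else if k = 6 then 1 else if k = 8 then 3 else
        if k = 9 then 16 else 0) h9
    rw [hcard] at this
    revert this
    decide

end Matrix

/-! ### Rank in column matroids -/

namespace Matrix

variable {m E F : Type*} [Finite E] [Field F] (A : Matrix m E F)

theorem columnMatroid_indep_iff {I : Set E} :
    A.columnMatroid.Indep I ↔ LinearIndepOn F A.col I := Iff.rfl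

theorem columnMatroid_ground : A.columnMatroid.E = Set.univ := rfl

theorem natRk_columnMatroid (S : Set E) :
    A.columnMatroid.natRk S = Module.finrank F (Submodule.span F (A.col '' S)) := by
  obtain ⟨I, hI⟩ := A.columnMatroid.exists_isBasis S (Set.subset_univ S)
  have hspan : Submodule.span F (A.col '' S) = Submodule.span F (A.col '' I) := by
    refine le_antisymm (Submodule.span_le.2 ?_) (Submodule.span_mono (Set.image_mono hI.subset))
    rintro _ ⟨e, he, rfl⟩
    by_contra hne
    have hins : A.columnMatroid.Indep (insert e I) :=
      LinearIndepOn.insert (A.columnMatroid_indep_iff.1 hI.indep) hne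
    exact hne (Submodule.subset_span
      ⟨e, hI.mem_of_insert_indep he hins, rfl⟩)
  have : Fintype I := Fintype.ofFinite I
  have h := finrank_span_eq_card (R := F) (b := fun x : I => A.col x)
    (A.columnMatroid_indep_iff.1 hI.indep)
  rw [show Set.range (fun x : I => A.col x) = A.col '' I by ext y; simp] at h
  rw [hspan, h, Matroid.natRk, ← hI.encard_eq_eRk, ← Nat.card_eq_fintype_card,
    Nat.card_coe_set_eq, Set.ncard_def]

/-- The columns in `S` lie in the hyperplane orthogonal to `x`. -/
theorem natRk_columnMatroid_lt [Fintype m] {S : Set E} {x : m → F} (hx : x ≠ 0)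
    (h : ∀ e ∈ S, x ⬝ᵥ A.col e = 0) : A.columnMatroid.natRk S < Fintype.card m := by
  classical
  rw [natRk_columnMatroid, ← Module.finrank_fintype_fun_eq_card F]
  refine Submodule.finrank_lt fun htop => hx ?_
  have hle : Submodule.span F (A.col '' S) ≤ LinearMap.ker (dotProductBilin F F x) := by
    rw [Submodule.span_le]
    rintro _ ⟨e, he, rfl⟩
    exact h e he
  rw [htop] at hle
  ext i
  have : x ⬝ᵥ Pi.single i 1 = 0 := hle (Submodule.mem_top (x := Pi.single i 1))
  simpa using this

end Matrix

/-! ### The isotropic matroid and vertical separations -/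

namespace LoopedGraph

open Finset Matrix

variable {V : Type*} (G : LoopedGraph V)

theorem adjMatrix_isSymm : G.adjMatrix.IsSymm := by
  ext v w
  simp only [transpose_apply, adjMatrix, of_apply]
  congr 1
  exact propext ⟨G.symm w v, G.symm v w⟩

theorem IAS_col_phi [DecidableEq V] (v : V) : G.IAS.col (phi v) = Pi.single v 1 := by
  ext u
  simp only [IAS, phi, col_apply, fromCols_apply_inl, one_apply, Pi.single_apply]
  congr

theorem IAS_col_chi (v : V) : G.IAS.col (chi v) = G.adjMatrix.col v := by
  ext u
  simp [IAS, chi]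

theorem IAS_col_psi [DecidableEq V] (v : V) :
    G.IAS.col (psi v) = G.adjMatrix.col v + Pi.single v 1 := by
  ext u
  simp only [IAS, psi, col_apply, fromCols_apply_inr, Matrix.add_apply, one_apply, Pi.single_apply,
    Pi.add_apply]
  congr

theorem eq_of_mem_vertexTriple {v w : V} {e : Column V} (hv : e ∈ vertexTriple v)
    (hw : e ∈ vertexTriple w) : v = w := by
  rcases hv with rfl | rfl | rfl <;> rcases hw with h | h | h <;>
    simp only [phi, chi, psi, Sum.inl.injEq, Sum.inr.injEq, Set.mem_singleton_iff,
      reduceCtorEq] at h <;>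
    exact h

variable [Fintype V]

theorem natRk_isotropicMatroid_ground :
    G.isotropicMatroid.natRk G.isotropicMatroid.E = Fintype.card V := by
  classical
  rw [isotropicMatroid, columnMatroid_ground, natRk_columnMatroid]
  suffices h : Submodule.span (ZMod 2) (G.IAS.col '' Set.univ) = ⊤ by
    rw [h, finrank_top, Module.finrank_fintype_fun_eq_card]
  rw [eq_top_iff, ← (Pi.basisFun (ZMod 2) V).span_eq, Submodule.span_le]
  rintro _ ⟨v, rfl⟩
  refine Submodule.subset_span ⟨phi v, trivial, ?_⟩
  rw [IAS_col_phi, Pi.basisFun_apply]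

theorem card_le_natRk_add_natRk_compl (S : Set (Column V)) :
    Fintype.card V ≤ G.isotropicMatroid.natRk S +
      G.isotropicMatroid.natRk (G.isotropicMatroid.E \ S) := by
  rw [← G.natRk_isotropicMatroid_ground, isotropicMatroid, columnMatroid_ground]
  simp only [natRk_columnMatroid]
  rw [← Set.union_sdiff_cancel (Set.subset_univ S), Set.image_union, Submodule.span_union,
    Set.union_sdiff_cancel (Set.subset_univ S)]
  exact Submodule.finrank_add_le_finrank_add_finrank _ _

/-- The union of the vertex triples of the elements of `D`. -/
def triples (D : Finset V) : Set (Column V) := ⋃ v ∈ D, vertexTriple v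

/-- A word is orthogonal to the columns of all vertices outside its support. -/
theorem dotProduct_IAS_col_eq_zero {x : V → ZMod 2} {v : V}
    (hv : v ∉ G.adjMatrix.wordSupport x) {e : Column V} (he : e ∈ vertexTriple v) :
    x ⬝ᵥ G.IAS.col e = 0 := by
  classical
  obtain ⟨h1, h2⟩ := notMem_wordSupport.1 hv
  have hchi : x ⬝ᵥ G.adjMatrix.col v = 0 := by
    rw [← h2, dotProduct_comm, mulVec]
    congr 1
    ext u
    exact G.adjMatrix_isSymm.apply v u
  rcases he with rfl | rfl | rfl
  · simp [IAS_col_phi, h1]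
  · rw [IAS_col_chi, hchi]
  · rw [IAS_col_psi, dotProduct_add, hchi]
    simp [h1]

theorem not_isVerticallyConnected_of_light_word {x : V → ZMod 2} (hx : x ≠ 0)
    (hlight : 2 * #(G.adjMatrix.wordSupport x) ≤ Fintype.card V) :
    ¬ G.isotropicMatroid.IsVerticallyConnected (Fintype.card V) := by
  classical
  set D := G.adjMatrix.wordSupport x with hD
  rintro ⟨-, hκ⟩
  -- `Dᶜ` holds at least half of the vertices, so by duality its space of words is at least as large
  -- as that of `D`.
  obtain ⟨y, hy, hyD⟩ : ∃ y ≠ 0, G.adjMatrix.wordSupport y ⊆ Dᶜ := by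
    have hfr := finrank_wordsIn_compl _ G.adjMatrix_isSymm D
    have hpos : 0 < Module.finrank (ZMod 2) (G.adjMatrix.wordsIn D) := by
      rw [Module.finrank_pos_iff_exists_ne_zero]
      exact ⟨⟨x, mem_wordsIn.2 subset_rfl⟩, fun h => hx (congrArg Subtype.val h)⟩
    have hpos' : 0 < Module.finrank (ZMod 2) (G.adjMatrix.wordsIn Dᶜ) := by omega
    rw [Module.finrank_pos_iff_exists_ne_zero] at hpos'
    obtain ⟨⟨y, hy⟩, hy0⟩ := hpos'
    exact ⟨y, fun h => hy0 (Subtype.ext h), mem_wordsIn.1 hy⟩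
  have ha : G.isotropicMatroid.natRk (triples D) < Fintype.card V := by
    refine natRk_columnMatroid_lt _ hy fun e he => ?_
    simp only [triples, Set.mem_iUnion] at he
    obtain ⟨v, hv, he⟩ := he
    exact G.dotProduct_IAS_col_eq_zero (fun h => Finset.mem_compl.1 (hyD h) hv) he
  have hb : G.isotropicMatroid.natRk (G.isotropicMatroid.E \ triples D) < Fintype.card V := by
    refine natRk_columnMatroid_lt _ hx fun e he => ?_
    obtain ⟨v, hv⟩ : ∃ v, e ∈ vertexTriple v := by
      rcases e with v | v | v
      · exact ⟨v, Or.inl rfl⟩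
      · exact ⟨v, Or.inr (Or.inl rfl)⟩
      · exact ⟨v, Or.inr (Or.inr rfl)⟩
    refine G.dotProduct_IAS_col_eq_zero (fun h => he.2 ?_) hv
    simp only [triples, Set.mem_iUnion]
    exact ⟨v, h, hv⟩
  have hn := G.natRk_isotropicMatroid_ground
  have hab := G.card_le_natRk_add_natRk_compl (triples D)
  set a := G.isotropicMatroid.natRk (triples D)
  set b := G.isotropicMatroid.natRk (G.isotropicMatroid.E \ triples D)
  -- The order is the connectivity of `triples D` plus one. As both ranks are at most n - 1, it is
  -- at most either rank, hence below n; `hab` keeps the subtraction from truncating.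
  have hsep : G.isotropicMatroid.IsVerticalSeparation (a + b - Fintype.card V + 1) (triples D) := by
    refine ⟨by omega, Set.subset_univ _, ?_, by omega, by omega⟩
    rw [Matroid.connectivityFunction, hn]
    push_cast [hab]
    omega
  have : G.isotropicMatroid.verticalConnectivity ≤ a + b - Fintype.card V + 1 :=
    Nat.sInf_le (Or.inl ⟨_, hsep⟩)
  omega

/-! ### Transverse circuits from words -/

open Classical in
/-- The column at `v` that records the pair of bits `(x v, (A x) v)` of a word. -/
noncomputable def wordColumn (x : V → ZMod 2) (v : V) : Column V :=
  -- Off the support this defaults to `phi v`, which only completes the transversal.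
  if x v = 0 then phi v else if (G.adjMatrix *ᵥ x) v = 0 then chi v else psi v

theorem wordColumn_mem_vertexTriple (x : V → ZMod 2) (v : V) :
    G.wordColumn x v ∈ vertexTriple v := by
  unfold wordColumn vertexTriple
  split_ifs <;> simp

theorem wordColumn_injective (x : V → ZMod 2) : Function.Injective (G.wordColumn x) :=
  fun v w h => eq_of_mem_vertexTriple (G.wordColumn_mem_vertexTriple x v)
    (h ▸ G.wordColumn_mem_vertexTriple x w)

theorem isTransversal_range_wordColumn (x : V → ZMod 2) :
    IsTransversal (Set.range (G.wordColumn x)) := by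
  intro v
  rw [Set.ncard_eq_one]
  refine ⟨G.wordColumn x v, Set.eq_singleton_iff_unique_mem.2
    ⟨⟨⟨v, rfl⟩, G.wordColumn_mem_vertexTriple x v⟩, ?_⟩⟩
  rintro _ ⟨⟨w, rfl⟩, hw⟩
  rw [eq_of_mem_vertexTriple (G.wordColumn_mem_vertexTriple x w) hw]

/-- On the support the chosen column is (A x)_v e_v + x_v A_v, and these sum to A x + A x = 0. -/
theorem sum_IAS_col_wordColumn (x : V → ZMod 2) :
    ∑ v ∈ G.adjMatrix.wordSupport x, G.IAS.col (G.wordColumn x v) = 0 := by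
  classical
  have hcol : ∀ v ∈ G.adjMatrix.wordSupport x, G.IAS.col (G.wordColumn x v) =
      Pi.single v ((G.adjMatrix *ᵥ x) v) + x v • G.adjMatrix.col v := by
    intro v hv
    have hbit : ∀ a : ZMod 2, a ≠ 0 → a = 1 := by decide
    unfold wordColumn
    split_ifs with h1 h2
    · have h2 : (G.adjMatrix *ᵥ x) v ≠ 0 := fun h2 => notMem_wordSupport.2 ⟨h1, h2⟩ hv
      rw [IAS_col_phi, h1, hbit _ h2, zero_smul, add_zero]
    · rw [IAS_col_chi, h2, hbit _ h1, one_smul, Pi.single_zero, zero_add]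
    · rw [IAS_col_psi, hbit _ h1, hbit _ h2, one_smul, add_comm]
  rw [Finset.sum_congr rfl hcol, Finset.sum_subset (Finset.subset_univ _), Finset.sum_add_distrib,
    Finset.univ_sum_single]
  · have : ∑ v, x v • G.adjMatrix.col v = G.adjMatrix *ᵥ x := by
      ext u
      simp [mulVec, dotProduct, mul_comm]
    rw [this]
    ext u
    exact CharTwo.add_self_eq_zero _
  · intro v _ hv
    obtain ⟨h1, h2⟩ := notMem_wordSupport.1 hv
    simp [h1, h2]

theorem exists_isTransverseCircuit_ncard_le {x : V → ZMod 2} (hx : x ≠ 0) :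
    ∃ C, G.IsTransverseCircuit C ∧ C.ncard ≤ #(G.adjMatrix.wordSupport x) := by
  classical
  set D := G.adjMatrix.wordSupport x with hD
  have hsub : G.wordColumn x '' D ⊆ Set.range (G.wordColumn x) := Set.image_subset_range _ _
  have hdep : (G.isotropicMatroid.restrict (Set.range (G.wordColumn x))).Dep
      (G.wordColumn x '' D) := by
    rw [Matroid.Dep, Matroid.restrict_indep_iff, Matroid.restrict_ground_eq]
    refine ⟨fun h => ?_, hsub⟩
    have hli : LinearIndepOn (ZMod 2) (G.IAS.col ∘ G.wordColumn x) (D : Set V) :=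
      LinearIndepOn.comp_of_image (columnMatroid_indep_iff _ |>.1 h.1)
        (G.wordColumn_injective x).injOn
    rw [linearIndepOn_finset_iff] at hli
    have hD0 : D.Nonempty := by
      rw [Finset.nonempty_iff_ne_empty]
      exact fun h => hx (wordSupport_eq_empty.1 h)
    obtain ⟨v, hv⟩ := hD0
    have := hli (fun _ => 1) (by simpa using G.sum_IAS_col_wordColumn x) v hv
    exact one_ne_zero this
  obtain ⟨C, hCD, hC⟩ := hdep.exists_isCircuit_subset
  refine ⟨C, ⟨_, G.isTransversal_range_wordColumn x, hC⟩, ?_⟩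
  calc C.ncard ≤ (G.wordColumn x '' D).ncard := Set.ncard_le_ncard hCD (Set.toFinite _)
    _ ≤ (D : Set V).ncard := Set.ncard_image_le (Set.toFinite _)
    _ = #D := Set.ncard_coe_finset D

end LoopedGraph

/-! ### Local complementation and small degree -/

namespace LoopedGraph

open Finset Matrix

variable {V : Type*}

open Classical in
/-- The adjacency matrix of the graph with all loops removed. -/
noncomputable def simpleAdjMatrix (G : LoopedGraph V) : Matrix V V (ZMod 2) :=
  Matrix.of fun v w => if w ∈ G.neighbors v then 1 else 0

theorem simpleAdjMatrix_comm (G : LoopedGraph V) (v w : V) :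
    G.simpleAdjMatrix v w = G.simpleAdjMatrix w v := by
  simp only [simpleAdjMatrix, of_apply, neighbors, Set.mem_ofPred_eq]
  congr 1
  exact propext ⟨fun h => ⟨h.1.symm, G.symm _ _ h.2⟩, fun h => ⟨h.1.symm, G.symm _ _ h.2⟩⟩

theorem simpleAdjMatrix_self (G : LoopedGraph V) (v : V) : G.simpleAdjMatrix v v = 0 := by
  simp [simpleAdjMatrix, neighbors]

theorem simpleAdjMatrix_ne_zero {G : LoopedGraph V} {v w : V} :
    G.simpleAdjMatrix v w ≠ 0 ↔ w ∈ G.neighbors v := by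
  simp [simpleAdjMatrix]

theorem simpleAdjMatrix_simpleLocalComplement [DecidableEq V] (G : LoopedGraph V) (v a b : V) :
    (G.simpleLocalComplement v).simpleAdjMatrix a b = G.simpleAdjMatrix a b +
      if b = a then 0 else G.simpleAdjMatrix v a * G.simpleAdjMatrix v b := by
  by_cases hab : b = a
  · simp [hab, simpleAdjMatrix_self]
  · have hmem : b ∈ (G.simpleLocalComplement v).neighbors a ↔
        Xor (b ∈ G.neighbors a) (a ∈ G.neighbors v ∧ b ∈ G.neighbors v) := by
      change b ≠ a ∧ Xor (G.Edge a b) (a ≠ b ∧ a ∈ G.neighbors v ∧ b ∈ G.neighbors v) ↔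
        Xor (b ≠ a ∧ G.Edge a b) _
      simp only [ne_eq, hab, Ne.symm hab, not_false_eq_true, true_and]
    simp only [simpleAdjMatrix, of_apply, hab, if_false]
    by_cases h1 : b ∈ G.neighbors a <;> by_cases h2 : a ∈ G.neighbors v <;>
      by_cases h3 : b ∈ G.neighbors v <;> simp [hmem, Xor, h1, h2, h3, CharTwo.add_self_eq_zero]

variable [Fintype V]

/-- A loop at v changes (A x)_v by x_v, which cannot affect whether the pair of bits is zero. -/
theorem wordSupport_simpleAdjMatrix (G : LoopedGraph V) (x : V → ZMod 2) :
    G.simpleAdjMatrix.wordSupport x = G.adjMatrix.wordSupport x := by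
  classical
  have hA : G.adjMatrix = G.simpleAdjMatrix + diagonal fun v => if G.Edge v v then 1 else 0 := by
    ext v w
    by_cases h : w = v
    · subst h; simp [adjMatrix, simpleAdjMatrix, neighbors]
    · simp [adjMatrix, simpleAdjMatrix, neighbors, h, diagonal_apply_ne _ (Ne.symm h)]
  ext v
  rw [← not_iff_not, notMem_wordSupport, notMem_wordSupport, hA, add_mulVec, Pi.add_apply,
    mulVec_diagonal]
  refine and_congr_right fun h => ?_
  rw [h, mul_zero, add_zero]

/-- Local complementation adds a aᵀ with its diagonal erased, a being row v. The correction to x at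
v cancels the term a (A x)_v; the erased diagonal leaves a_u x_u. -/
theorem simpleLocalComplement_mulVec [DecidableEq V] (G : LoopedGraph V) (v : V) (x : V → ZMod 2)
    (u : V) :
    ((G.simpleLocalComplement v).simpleAdjMatrix *ᵥ
        (x + Pi.single v ((G.simpleAdjMatrix *ᵥ x) v))) u =
      (G.simpleAdjMatrix *ᵥ x) u + G.simpleAdjMatrix v u * x u := by
  have hsq : ∀ a : ZMod 2, a * a = a := by decide
  have h1 : ((G.simpleLocalComplement v).simpleAdjMatrix *ᵥ x) u =
      (G.simpleAdjMatrix *ᵥ x) u + G.simpleAdjMatrix v u * (G.simpleAdjMatrix *ᵥ x) v +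
        G.simpleAdjMatrix v u * x u := by
    have hu : G.simpleAdjMatrix v u * x u =
        ∑ b, if b = u then G.simpleAdjMatrix v u * x u else 0 := by
      simp
    rw [hu]
    simp only [mulVec, dotProduct]
    rw [Finset.mul_sum, ← Finset.sum_add_distrib, ← Finset.sum_add_distrib]
    refine Finset.sum_congr rfl fun b _ => ?_
    rw [simpleAdjMatrix_simpleLocalComplement]
    split_ifs with h
    · subst h
      rw [← mul_assoc, hsq, add_zero, add_assoc, CharTwo.add_self_eq_zero, add_zero]
    · ring
  rw [mulVec_add, Pi.add_apply, h1, mulVec_single, Pi.smul_apply, col_apply,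
    simpleAdjMatrix_simpleLocalComplement, simpleAdjMatrix_self, G.simpleAdjMatrix_comm u v]
  generalize G.simpleAdjMatrix v u = a
  generalize (G.simpleAdjMatrix *ᵥ x) v = b
  generalize (G.simpleAdjMatrix *ᵥ x) u = c
  generalize x u = d
  rw [mul_zero, ite_self, add_zero]
  simp only [MulOpposite.smul_eq_mul_unop, MulOpposite.unop_op]
  linear_combination a * b * CharTwo.two_eq_zero (R := ZMod 2)

/-- Local complementation at `v` carries words to words with the same support. -/
theorem wordSupport_simpleLocalComplement [DecidableEq V] (G : LoopedGraph V) (v : V)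
    (x : V → ZMod 2) :
    (G.simpleLocalComplement v).simpleAdjMatrix.wordSupport
        (x + Pi.single v ((G.simpleAdjMatrix *ᵥ x) v)) = G.simpleAdjMatrix.wordSupport x := by
  ext u
  rw [← not_iff_not, notMem_wordSupport, notMem_wordSupport, simpleLocalComplement_mulVec]
  by_cases hu : u = v
  · subst hu
    simp only [simpleAdjMatrix_self, Pi.add_apply, Pi.single_eq_same]
    generalize x u = a
    generalize (G.simpleAdjMatrix *ᵥ x) u = b
    revert a b
    decide
  · simp only [Pi.add_apply, Pi.single_eq_of_ne hu, add_zero]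
    refine and_congr_right fun h => ?_
    rw [h, mul_zero, add_zero]

/-- Some graph locally equivalent to `G` has a generating word of weight at most `t`. -/
def HasLightGenerator [DecidableEq V] (G : LoopedGraph V) (t : ℕ) : Prop :=
  ∃ H, G.LocallyEquivalent H ∧ ∃ v, #(H.simpleAdjMatrix.wordSupport (Pi.single v 1)) ≤ t

theorem HasLightGenerator.of_simpleLocalComplement [DecidableEq V] {G : LoopedGraph V} {v : V}
    {t : ℕ} (h : (G.simpleLocalComplement v).HasLightGenerator t) : G.HasLightGenerator t := by
  obtain ⟨H, hH, hv⟩ := h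
  exact ⟨H, Relation.ReflTransGen.head (.simple v) hH, hv⟩

/-- Every nonzero word can be turned into a generator of at most the same weight by local
complementations, which successively remove vertices from the set `{v | x v ≠ 0}`. -/
theorem hasLightGenerator_of_ne_zero [DecidableEq V] (k : ℕ) :
    ∀ (G : LoopedGraph V) (x : V → ZMod 2), #{v | x v ≠ 0} = k + 1 →
      G.HasLightGenerator #(G.simpleAdjMatrix.wordSupport x) := by
  have hbit : ∀ a : ZMod 2, a ≠ 0 → a = 1 := by decide
  induction k with
  | zero =>
    intro G x hx
    obtain ⟨v, hv⟩ := Finset.card_eq_one.1 hx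
    have hxv : x = Pi.single v 1 := by
      ext u
      have hu : u ∈ ({v | x v ≠ 0} : Finset V) ↔ u ∈ ({v} : Finset V) := by rw [hv]
      simp only [mem_filter, mem_univ, true_and, mem_singleton] at hu
      by_cases huv : u = v
      · rw [hbit _ (hu.2 huv), huv, Pi.single_eq_same]
      · rw [Pi.single_eq_of_ne huv, not_not.1 (mt hu.1 huv)]
    exact ⟨G, .refl, v, hxv ▸ le_rfl⟩
  | succ k ih =>
    -- Where both bits are 1, complementing at `v` clears x_v and changes no other entry of `x`.
    have odd_vertex : ∀ (G : LoopedGraph V) (x : V → ZMod 2), #{v | x v ≠ 0} = k + 2 →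
        ∀ v, x v ≠ 0 → (G.simpleAdjMatrix *ᵥ x) v ≠ 0 →
        G.HasLightGenerator #(G.simpleAdjMatrix.wordSupport x) := by
      intro G x hx v hxv hzv
      rw [← G.wordSupport_simpleLocalComplement v]
      refine (ih _ _ ?_).of_simpleLocalComplement
      have : ({u | (x + Pi.single v ((G.simpleAdjMatrix *ᵥ x) v) : V → ZMod 2) u ≠ 0} : Finset V) =
          ({u | x u ≠ 0} : Finset V).erase v := by
        ext u
        simp only [mem_filter, mem_univ, true_and, mem_erase, Pi.add_apply]
        by_cases huv : u = v
        · subst huv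
          simp [hbit _ hxv, hbit _ hzv, CharTwo.add_self_eq_zero]
        · simp [huv]
      rw [this, Finset.card_erase_of_mem (by simpa using hxv), hx]
      rfl
    -- If neither end has second bit 1, complementing at `v` fixes `x` and flips the second bit at
    -- `w`, so `odd_vertex` applies there.
    have edge : ∀ (G : LoopedGraph V) (x : V → ZMod 2), #{v | x v ≠ 0} = k + 2 →
        ∀ v w, x v ≠ 0 → x w ≠ 0 → G.simpleAdjMatrix v w ≠ 0 →
        G.HasLightGenerator #(G.simpleAdjMatrix.wordSupport x) := by
      intro G x hx v w hxv hxw hvw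
      by_cases hzv : (G.simpleAdjMatrix *ᵥ x) v = 0
      swap
      · exact odd_vertex G x hx v hxv hzv
      by_cases hzw : (G.simpleAdjMatrix *ᵥ x) w = 0
      swap
      · exact odd_vertex G x hx w hxw hzw
      have h1 := G.wordSupport_simpleLocalComplement v x
      have h2 := G.simpleLocalComplement_mulVec v x w
      rw [hzv, Pi.single_zero, add_zero] at h1 h2
      rw [← h1]
      refine (odd_vertex _ x hx w hxw ?_).of_simpleLocalComplement
      rw [h2, hzw, zero_add]
      exact mul_ne_zero hvw hxw
    intro G x hx
    obtain ⟨v, hv⟩ : ({v | x v ≠ 0} : Finset V).Nonempty := Finset.card_pos.1 (by omega)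
    simp only [mem_filter, mem_univ, true_and] at hv
    by_cases hu : ∃ u, G.simpleAdjMatrix u v ≠ 0 ∧ (G.simpleAdjMatrix *ᵥ x) u = 0
    -- As (A x)_u = 0, `u` has a second neighbor `w` with x_w = 1; if `v` and `w` are not adjacent,
    -- complementing at `u` joins them and fixes `x`.
    · obtain ⟨u, huv, hzu⟩ := hu
      obtain ⟨w, hwv, hw⟩ : ∃ w, w ≠ v ∧ G.simpleAdjMatrix u w * x w ≠ 0 := by
        by_contra! hcon
        refine mul_ne_zero huv hv ?_
        rw [← hzu, mulVec, dotProduct, Finset.sum_eq_single v (fun b _ hb => hcon b hb) (by simp)]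
      by_cases hvw : G.simpleAdjMatrix v w = 0
      swap
      · exact edge G x hx v w hv (right_ne_zero_of_mul hw) hvw
      have h1 := G.wordSupport_simpleLocalComplement u x
      rw [hzu, Pi.single_zero, add_zero] at h1
      rw [← h1]
      refine (edge _ x hx v w hv (right_ne_zero_of_mul hw) ?_).of_simpleLocalComplement
      rw [simpleAdjMatrix_simpleLocalComplement, hvw, if_neg hwv, zero_add]
      exact mul_ne_zero huv (left_ne_zero_of_mul hw)
    -- Otherwise the support of the word contains the closed neighborhood of `v`, so e_v is no
    -- heavier.
    · push Not at hu
      refine ⟨G, .refl, v, Finset.card_le_card fun u => ?_⟩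
      rw [← not_imp_not, notMem_wordSupport, notMem_wordSupport]
      rintro ⟨hxu, hzu⟩
      have huv : u ≠ v := fun h => hv (h ▸ hxu)
      refine ⟨Pi.single_eq_of_ne huv _, ?_⟩
      have : G.simpleAdjMatrix u v = 0 := by
        by_contra h
        exact hu u h hzu
      simpa using this

theorem card_wordSupport_single [DecidableEq V] (G : LoopedGraph V) (v : V) :
    #(G.simpleAdjMatrix.wordSupport (Pi.single v 1)) = (G.neighbors v).ncard + 1 := by
  have hv : v ∉ G.neighbors v := fun h => h.1 rfl
  rw [← Set.ncard_insert_of_notMem hv (Set.toFinite _), ← Set.ncard_coe_finset]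
  congr 1
  ext u
  rw [← not_iff_not, Finset.mem_coe, notMem_wordSupport, Set.mem_insert_iff,
    ← simpleAdjMatrix_ne_zero, G.simpleAdjMatrix_comm v u]
  by_cases huv : u = v
  · simp [huv]
  · simp [huv]

theorem exists_locallyEquivalent_degree_lt (G : LoopedGraph V) {x : V → ZMod 2} (hx : x ≠ 0) :
    ∃ H, G.LocallyEquivalent H ∧ ∃ v, H.degree v < #(G.adjMatrix.wordSupport x) := by
  classical
  have hpos : 0 < #{v | x v ≠ 0} := by
    obtain ⟨v, hv⟩ := Function.ne_iff.1 hx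
    exact Finset.card_pos.2 ⟨v, by simpa using hv⟩
  obtain ⟨k, hk⟩ := Nat.exists_eq_add_one.2 hpos
  obtain ⟨H, hGH, v, hv⟩ := hasLightGenerator_of_ne_zero k G x hk
  rw [wordSupport_simpleAdjMatrix G, card_wordSupport_single] at hv
  -- A loop would add two to the degree; removing it keeps the neighborhood.
  by_cases hloop : H.Edge v v
  · refine ⟨H.loopComplement v, hGH.tail (.loop v), v, ?_⟩
    have hN : (H.loopComplement v).neighbors v = H.neighbors v := by
      ext w
      simp only [neighbors, Set.mem_ofPred_eq]
      refine and_congr_right fun hw => ?_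
      simp [loopComplement, loopComplementOn, Xor, hw.symm]
    have hl : ¬ (H.loopComplement v).Edge v v := by
      simp [loopComplement, loopComplementOn, Xor, hloop]
    rw [degree, hN, if_neg hl]
    omega
  · refine ⟨H, hGH, v, ?_⟩
    rw [degree, if_neg hloop]
    omega

end LoopedGraph

theorem corollary6 {V : Type*} [Fintype V] (G : LoopedGraph V) (hn : 7 ≤ Fintype.card V) :
    (∃ H : LoopedGraph V, G.LocallyEquivalent H ∧
      ∃ v : V, (H.degree v : ℝ) < ((Fintype.card V : ℝ) - 1) / 2) ∧
    ¬ G.isotropicMatroid.IsVerticallyConnected (Fintype.card V) ∧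
    (∃ C : Set (LoopedGraph.Column V), G.IsTransverseCircuit C ∧
      (C.ncard : ℝ) ≤ (Fintype.card V : ℝ) / 2) := by
  obtain ⟨x, hx, hlight⟩ := Matrix.exists_light_word G.adjMatrix G.adjMatrix_isSymm hn
  refine ⟨?_, G.not_isVerticallyConnected_of_light_word hx hlight, ?_⟩
  · obtain ⟨H, hGH, v, hv⟩ := G.exists_locallyEquivalent_degree_lt hx
    refine ⟨H, hGH, v, ?_⟩
    -- The degree is strictly below the weight, hence at most n/2 - 1.
    have h : 2 * H.degree v + 1 < Fintype.card V := by omega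
    have h' : 2 * (H.degree v : ℝ) + 1 < Fintype.card V := by exact_mod_cast h
    linarith
  · obtain ⟨C, hC, hcard⟩ := G.exists_isTransverseCircuit_ncard_le hx
    refine ⟨C, hC, ?_⟩
    have h : 2 * C.ncard ≤ Fintype.card V := by omega
    have h' : 2 * (C.ncard : ℝ) ≤ Fintype.card V := by exact_mod_cast h
    linarith
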